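/- All manifolds are smooth and finite-dimensional. Let $G$ and $K$ be Lie groups with Lie algebras $\mathfrak g=T_1G$ and $\mathfrak k=T_1K$, let $M$ be a manifold with a smooth left $G$-action, and let $\pi\colon Q\to M$ be a $G$-equivariant principal $K$-bundle: a smooth principal (right) $K$-bundle, together with a smooth left $G$-action on $Q$ which commutes with the $K$-action and for which $\pi$ is $G$-equivariant. For $A\in\mathfrak g$ let $\rho(A)$ be the vector field $\rho_q(A)=\frac{d}{dt}\big|_{t=0}e^{-tA}q$ on $Q$. A connection on $Q$ is a smooth form $\Theta\in\Omega^1(Q;\mathfrak k)$ with $\Theta_q\big(\frac{d}{dt}\big|_{t=0}q\,e^{tB}\big)=B$ for all $q \in Q$, $B\in\mathfrak k$, and $R_k^*\Theta=\mathrm{Ad}_{k^{-1}}\Theta$ for all $k\in K$, where $R_k(q)=qk$. It is $G$-invariant if $g^*\Theta=\Theta$ for all $g\in G$, and $G$-basic if it is $G$-invariant and $\Theta(\rho(A))=0$ for all $A\in\mathfrak g$. Let $d_0,d_1\colon G\times M\to M$ be $d_0(g,m)=m$ and $d_1(g,m)=gm$, let $d_i^*Q=\{(g,m,q)\in G\times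 M\times Q : d_i(g,m)=\pi(q)\}$ be the pullback bundles, with the pulled back connections $d_i^*\Theta\in\Omega^1(d_i^*Q;\mathfrak k)$, and let $\Psi\colon d_0^*Q\to d_1^*Q$, $\Psi(g,m,q)=(g,m,gq)$, be the bundle isomorphism given by the action. Let $\theta_{\mathfrak g}$ be the Maurer–Cartan form of $G$, $(\theta_{\mathfrak g})_g(v)=g^{-1}\cdot v$, and denote its pullback to $G\times M$ along the projection to $G$ by the same symbol. Let $\iota_{\rho(\theta_{\mathfrak g})}d_0^*\Theta$ be the $\mathfrak k$-valued 1-form on $d_0^*Q$ which sends a tangent vector $w$ at $(g,m,q)$, with image $v\in T_{(g,m)}(G\times M)$, to $\Theta_q\big(\rho_q(\theta_{\mathfrak g}(v))\big)$. Then for every connection $\Theta$ on $Q$: 1. $\Theta$ is $G$-invariant if and only if $\Psi^*d_1^*\Theta=(1-\iota_{\rho(\theta_{\mathfrak g})})\,d_0^*\Theta$, that is, $\Psi^*d_1^*\Theta=d_0^*\Theta-\iota_{\rho(\theta_{\mathfrak g})}d_0^*\Theta$. 2. $\Theta$ is $G$-basic if and only if it is $G$-invariant and $\Psi^*d_1^*\Theta=d_0^*\Theta$.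 -/

import Mathlib

open scoped Manifold ContDiff

noncomputable section

section LieExp

variable {EG HG G : Type*} [NormedAddCommGroup EG] [NormedSpace ℝ EG] [TopologicalSpace HG]
  {IG : ModelWithCorners ℝ EG HG} [TopologicalSpace G] [ChartedSpace HG G] [Group G]
  [LieGroup IG ∞ G]

lemma mulInvariantVectorField_smooth (A : GroupLieAlgebra IG G) :
    ContMDiff IG IG.tangent 1
      (fun g : G ↦ (⟨g, mulInvariantVectorField A g⟩ : TangentBundle IG G)) := by
  have h3 : LieGroup IG (minSmoothness ℝ 3) G := by
    rw [minSmoothness_of_isRCLikeNormedField]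
    exact LieGroup.of_le (m := 3) (n := ∞) ENat.LEInfty.out
  refine (contMDiff_mulInvariantVectorField A).of_le ?_
  rw [minSmoothness_of_isRCLikeNormedField]
  norm_num

lemma contMDiff_left_mul (g : G) : ContMDiff IG IG ∞ (fun h : G ↦ g * h) :=
  contMDiff_mul_left

lemma mfderiv_mulInvariantVectorField (A : GroupLieAlgebra IG G) (g h : G) :
    mfderiv IG IG (fun x : G ↦ g * x) h (mulInvariantVectorField A h) =
      mulInvariantVectorField A (g * h) := by
  have key : mfderiv IG IG (fun x : G ↦ g * h * x) 1 =
      (mfderiv IG IG (fun x : G ↦ g * x) (h * 1)).comp (mfderiv IG IG (fun x : G ↦ h * x) 1) := by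
    rw [← mfderiv_comp (I' := IG) (1 : G)
      ((contMDiff_left_mul g).mdifferentiableAt (by simp))
      ((contMDiff_left_mul h).mdifferentiableAt (by simp))]
    congr 1
    funext x
    simp [mul_assoc]
  have h1 : ∀ z : G, z = h → ∀ w : EG,
      (mfderiv IG IG (fun x : G ↦ g * x) z : EG →L[ℝ] EG) w =
      (mfderiv IG IG (fun x : G ↦ g * x) h : EG →L[ℝ] EG) w := by
    rintro z rfl w; rfl
  have h2 := DFunLike.congr_fun (F := EG →L[ℝ] EG) key A
  exact ((h2.trans (h1 (h * 1) (mul_one h) _))).symm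

theorem exists_lieExpCurve [FiniteDimensional ℝ EG] [BoundarylessManifold IG G] [T2Space G]
    (A : GroupLieAlgebra IG G) :
    ∃ γ : ℝ → G, γ 0 = 1 ∧ IsMIntegralCurve (I := IG) γ (mulInvariantVectorField A) := by
  have hc : CompleteSpace EG := FiniteDimensional.complete ℝ EG
  have hv := mulInvariantVectorField_smooth (IG := IG) A
  have hman : IsManifold IG 1 G := (inferInstance : IsManifold IG 1 G)
  obtain ⟨γ, h0, hγ⟩ :=
    exists_isMIntegralCurveAt_of_contMDiffAt_boundaryless (I := IG) (t₀ := 0) (x₀ := (1 : G)) 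
      hv.contMDiffAt
  obtain ⟨ε, hε, hγ⟩ := isMIntegralCurveAt_iff'.1 hγ
  refine exists_isMIntegralCurve_of_isMIntegralCurveOn hv hε (fun x ↦ ?_) 1
  refine ⟨fun t ↦ x * γ t, by simp [h0], ?_⟩
  intro t ht
  have hb : t ∈ Metric.ball (0 : ℝ) ε := by simpa [Real.ball_eq_Ioo] using ht
  have h1 := hγ t hb
  have h2 : HasMFDerivAt IG IG (fun y : G ↦ x * y) (γ t) _ :=
    ((contMDiff_left_mul x).mdifferentiableAt (by simp)).hasMFDerivAt
  have h3 := h2.comp_hasMFDerivWithinAt t h1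
  rw [Real.ball_eq_Ioo, zero_sub, zero_add] at h3
  refine h3.congr_mfderiv ?_
  refine ContinuousLinearMap.ext_ring ?_
  change (mfderiv IG IG (fun y : G ↦ x * y) (γ t)) ((1 : ℝ) • mulInvariantVectorField A (γ t)) =
    (1 : ℝ) • mulInvariantVectorField A (x * γ t)
  rw [one_smul, one_smul]
  exact mfderiv_mulInvariantVectorField A x (γ t)


/-- `lieExp A t` is `e^{tA}`: the integral curve through `1` of the left-invariant vector field
generated by `A`, at time `t`. -/
def lieExp [FiniteDimensional ℝ EG] [BoundarylessManifold IG G] [T2Space G]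
    (A : GroupLieAlgebra IG G) : ℝ → G :=
  Classical.choose (exists_lieExpCurve A)

variable [FiniteDimensional ℝ EG] [BoundarylessManifold IG G] [T2Space G]

lemma lieExp_zero (A : GroupLieAlgebra IG G) : lieExp A 0 = 1 :=
  (Classical.choose_spec (exists_lieExpCurve A)).1

lemma isMIntegralCurve_lieExp (A : GroupLieAlgebra IG G) :
    IsMIntegralCurve (I := IG) (lieExp A) (mulInvariantVectorField A) :=
  (Classical.choose_spec (exists_lieExpCurve A)).2

variable {EQ HQ Q : Type*} [NormedAddCommGroup EQ] [NormedSpace ℝ EQ] [TopologicalSpace HQ]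
  {IQ : ModelWithCorners ℝ EQ HQ} [TopologicalSpace Q] [ChartedSpace HQ Q]

variable (IQ) in
/-- The vector field `ρ(A)` of a left action, `ρ_q(A) = d/dt|₀ (e^{-tA} q)`. The derivative is
taken in the tangent space at `e^{-0A} q = q`. -/
def leftVectorField [MulAction G Q] (A : GroupLieAlgebra IG G) (q : Q) : TangentSpace IQ q :=
  (mfderiv 𝓘(ℝ, ℝ) IQ (fun t : ℝ ↦ lieExp A (-t) • q) 0 : ℝ →L[ℝ] EQ) 1

variable (IQ) in
/-- The vector field `ρ(A)` of a right action, `ρ_q(A) = d/dt|₀ (q e^{tA})`. -/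
def rightVectorField [MulAction Gᵐᵒᵖ Q] (A : GroupLieAlgebra IG G) (q : Q) : TangentSpace IQ q :=
  (mfderiv 𝓘(ℝ, ℝ) IQ (fun t : ℝ ↦ MulOpposite.op (lieExp A t) • q) 0 : ℝ →L[ℝ] EQ) 1

lemma leftVectorField_eq [MulAction G Q] [ContMDiffSMul IG IQ ∞ G Q]
    (A : GroupLieAlgebra IG G) (q : Q) :
    leftVectorField IQ A q = -(mfderiv IG IQ (fun g : G ↦ g • q) 1 : EG →L[ℝ] EQ) A := by
  have hs : ContMDiff IG IQ ∞ (fun g : G ↦ g • q) :=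
    (contMDiff_smul (I := IG) (I' := IQ) (n := ∞) (G := G) (M := Q)).comp
      (contMDiff_id.prodMk contMDiff_const)
  have h1 := isMIntegralCurve_lieExp A (-0)
  have hn : HasMFDerivAt 𝓘(ℝ, ℝ) 𝓘(ℝ, ℝ) (fun t : ℝ ↦ -t) 0 (-ContinuousLinearMap.id ℝ ℝ) :=
    (hasFDerivAt_id (𝕜 := ℝ) (0 : ℝ)).neg.hasMFDerivAt
  have h2 := HasMFDerivAt.comp (0 : ℝ) (hs.mdifferentiableAt (by simp)).hasMFDerivAt
    (HasMFDerivAt.comp (0 : ℝ) h1 hn)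
  have h3 := h2.mfderiv
  have key : ∀ g : G, g = 1 → ∀ γ : ℝ → G,
      (mfderiv IG IQ (fun g : G ↦ g • q) g : EG →L[ℝ] EQ)
        (((-1 : ℝ) • mulInvariantVectorField A g : EG)) = 
      -(mfderiv IG IQ (fun g : G ↦ g • q) 1 : EG →L[ℝ] EQ) A := by
    rintro _ rfl -
    have hid : ∀ f : G → G, f = id → (mfderiv IG IG f 1 : EG →L[ℝ] EG) A = A := by
      rintro _ rfl
      rw [mfderiv_id]
      rfl
    have hA : mulInvariantVectorField A (1 : G) = A := hid _ (by funext x; simp)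
    rw [hA]
    simp
  have h4 := DFunLike.congr_fun (F := ℝ →L[ℝ] EQ) h3 1
  exact h4.trans (key _ (by simp [lieExp_zero]) (lieExp A))
 
variable (IG) in
/-- `ρ_q` as a continuous linear map `𝔤 → T_q Q`. -/
def leftVectorFieldL [MulAction G Q] [ContMDiffSMul IG IQ ∞ G Q] (q : Q) :
    GroupLieAlgebra IG G →L[ℝ] TangentSpace IQ q where
  toFun A := leftVectorField IQ A q
  map_add' A B := by
    simp only [leftVectorField_eq]
    exact (congrArg Neg.neg ((mfderiv IG IQ (fun g : G ↦ g • q) 1 : EG →L[ℝ] EQ).map_add A B)).trans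
      (neg_add _ _)
  map_smul' c A := by
    simp only [leftVectorField_eq]
    exact (congrArg Neg.neg ((mfderiv IG IQ (fun g : G ↦ g • q) 1 : EG →L[ℝ] EQ).map_smul c A)).trans
      (smul_neg c _).symm
  cont := by
    simp only [leftVectorField_eq]
    exact (mfderiv IG IQ (fun g : G ↦ g • q) 1 : EG →L[ℝ] EQ).continuous.neg

end LieExp

section Bundle

variable {EM HM M EQ HQ Q EK HK K EX HX X : Type*}
  [NormedAddCommGroup EM] [NormedSpace ℝ EM] [TopologicalSpace HM]
  [TopologicalSpace M] [ChartedSpace HM M]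
  [NormedAddCommGroup EQ] [NormedSpace ℝ EQ] [TopologicalSpace HQ]
  [TopologicalSpace Q] [ChartedSpace HQ Q]
  [NormedAddCommGroup EK] [NormedSpace ℝ EK] [TopologicalSpace HK]
  [TopologicalSpace K] [ChartedSpace HK K] [Group K]
  [NormedAddCommGroup EX] [NormedSpace ℝ EX] [TopologicalSpace HX]
  [TopologicalSpace X] [ChartedSpace HX X]
  {IM : ModelWithCorners ℝ EM HM} {IQ : ModelWithCorners ℝ EQ HQ}
  {IK : ModelWithCorners ℝ EK HK} {IX : ModelWithCorners ℝ EX HX}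

/-- `e` is a smooth `K`-equivariant trivialization of `proj : Q → M` over the open set `U`. The
right action of `K` on `Q` is an action of `Kᵐᵒᵖ`, so `q k` is `MulOpposite.op k • q`. -/
structure IsLocalTriv [MulAction Kᵐᵒᵖ Q] (IM : ModelWithCorners ℝ EM HM)
    (IQ : ModelWithCorners ℝ EQ HQ) (IK : ModelWithCorners ℝ EK HK) (proj : Q → M) (U : Set M)
    (e : OpenPartialHomeomorph Q (M × K)) : Prop where
  isOpen : IsOpen U
  source_eq : e.source = proj ⁻¹' U
  target_eq : e.target = U ×ˢ Set.univ
  fst_apply : ∀ q ∈ e.source, (e q).1 = proj q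
  apply_act : ∀ q ∈ e.source, ∀ k : K, e (MulOpposite.op k • q) = ((e q).1, (e q).2 * k)
  contMDiffOn : ContMDiffOn IQ (IM.prod IK) ∞ e e.source
  contMDiffOn_symm : ContMDiffOn (IM.prod IK) IQ ∞ e.symm e.target

/-- A smooth principal `K`-bundle `Q → M`: a smooth right action of `K` on `Q` and a projection
which is locally, and equivariantly, the projection of a product. -/
structure SmoothPrincipalBundle (IM : ModelWithCorners ℝ EM HM)
    (IQ : ModelWithCorners ℝ EQ HQ) (IK : ModelWithCorners ℝ EK HK) (M Q K : Type*)
    [TopologicalSpace M] [ChartedSpace HM M] [TopologicalSpace Q] [ChartedSpace HQ Q]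
    [TopologicalSpace K] [ChartedSpace HK K] [Group K] [MulAction Kᵐᵒᵖ Q] where
  proj : Q → M
  contMDiff_act : ContMDiff (IQ.prod IK) IQ ∞ (fun p : Q × K ↦ MulOpposite.op p.2 • p.1)
  proj_act : ∀ (q : Q) (k : K), proj (MulOpposite.op k • q) = proj q
  exists_triv : ∀ m : M, ∃ (U : Set M) (e : OpenPartialHomeomorph Q (M × K)),
    m ∈ U ∧ IsLocalTriv IM IQ IK proj U e

variable [MulAction Kᵐᵒᵖ Q]

namespace IsLocalTriv

variable {proj : Q → M} {U : Set M} {e : OpenPartialHomeomorph Q (M × K)}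

lemma proj_symm (he : IsLocalTriv IM IQ IK proj U e) {m : M} (hm : m ∈ U) (k : K) :
    proj (e.symm (m, k)) = m := by
  have ht : (m, k) ∈ e.target := by rw [he.target_eq]; exact ⟨hm, trivial⟩
  rw [← he.fst_apply _ (e.map_target ht), e.right_inv ht]

lemma mem_source (he : IsLocalTriv IM IQ IK proj U e) {q : Q} : q ∈ e.source ↔ proj q ∈ U := by
  rw [he.source_eq]; rfl

lemma mem_target (he : IsLocalTriv IM IQ IK proj U e) {z : M × K} : z ∈ e.target ↔ z.1 ∈ U := by
  rw [he.target_eq]; simp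

lemma symm_apply (he : IsLocalTriv IM IQ IK proj U e) {q : Q} (hq : proj q ∈ U) :
    e.symm (proj q, (e q).2) = q := by
  have hq' := he.mem_source.2 hq
  rw [← he.fst_apply q hq']
  exact e.left_inv hq'

end IsLocalTriv

namespace SmoothPrincipalBundle

variable (B : SmoothPrincipalBundle IM IQ IK M Q K)

lemma contMDiff_proj : ContMDiff IQ IM ∞ B.proj := by
  intro q
  obtain ⟨U, e, hU, he⟩ := B.exists_triv (B.proj q)
  have hq := he.mem_source.2 hU
  have h : ContMDiffAt IQ IM ∞ (fun q ↦ (e q).1) q :=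
    (he.contMDiffOn.contMDiffAt (e.open_source.mem_nhds hq)).fst
  refine h.congr_of_eventuallyEq ?_
  filter_upwards [e.open_source.mem_nhds hq] with y hy
  exact (he.fst_apply y hy).symm

lemma continuous_proj : Continuous B.proj := B.contMDiff_proj.continuous

end SmoothPrincipalBundle

/-- The total space `f^*Q = {(x, q) | f x = π q} ⊆ X × Q` of the pullback bundle, with its
projection `base` to `X` and its canonical map `total` to `Q`. -/
@[ext] structure PullbackBundle (f : C^∞⟮IX, X; IM, M⟯)
    (B : SmoothPrincipalBundle IM IQ IK M Q K) where
  base : X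
  total : Q
  base_total : f base = B.proj total

namespace PullbackBundle

variable {f : C^∞⟮IX, X; IM, M⟯} {B : SmoothPrincipalBundle IM IQ IK M Q K}

/-- The subspace topology. -/
instance : TopologicalSpace (PullbackBundle f B) :=
  TopologicalSpace.induced (fun p ↦ (p.base, p.total)) inferInstance

lemma isInducing : Topology.IsInducing (fun p : PullbackBundle f B ↦ (p.base, p.total)) := ⟨rfl⟩

lemma continuous_base : Continuous (base : PullbackBundle f B → X) :=
  continuous_fst.comp isInducing.continuous

lemma continuous_total : Continuous (total : PullbackBundle f B → Q) :=
  continuous_snd.comp isInducing.continuous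

/-- The right action of `K` on `f^*Q`, `(x, q) k = (x, q k)`. -/
instance : MulAction Kᵐᵒᵖ (PullbackBundle f B) where
  smul k p := ⟨p.base, k • p.total, p.base_total.trans (B.proj_act p.total k.unop).symm⟩
  one_smul p := PullbackBundle.ext rfl (one_smul _ p.total)
  mul_smul a b p := PullbackBundle.ext rfl (mul_smul a b p.total)

@[simp] lemma base_smul (k : Kᵐᵒᵖ) (p : PullbackBundle f B) : (k • p).base = p.base := rfl

@[simp] lemma total_smul (k : Kᵐᵒᵖ) (p : PullbackBundle f B) : (k • p).total = k • p.total := rfl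

variable {U V : Set M} {e e' : OpenPartialHomeomorph Q (M × K)}

open Classical in
/-- The inverse `(x, k) ↦ (x, e⁻¹ (f x, k))` of a trivialization of `f^*Q`, with a junk value `p₀`
outside of its domain. -/
def trivInv (he : IsLocalTriv IM IQ IK B.proj U e) (p₀ : PullbackBundle f B) (z : X × K) :
    PullbackBundle f B :=
  if hz : f z.1 ∈ U then ⟨z.1, e.symm (f z.1, z.2), (he.proj_symm hz z.2).symm⟩ else p₀

lemma trivInv_of_mem (he : IsLocalTriv IM IQ IK B.proj U e) (p₀ : PullbackBundle f B) {z : X × K}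
    (hz : f z.1 ∈ U) :
    trivInv he p₀ z = ⟨z.1, e.symm (f z.1, z.2), (he.proj_symm hz z.2).symm⟩ := dif_pos hz

/-- The trivialization `(x, q) ↦ (x, k)` of `f^*Q` over `f⁻¹ U` induced by a trivialization
`q ↦ (π q, k)` of `Q` over `U`. -/
def triv (he : IsLocalTriv IM IQ IK B.proj U e) (p₀ : PullbackBundle f B) :
    OpenPartialHomeomorph (PullbackBundle f B) (X × K) where
  toFun p := (p.base, (e p.total).2)
  invFun := trivInv he p₀
  source := {p | f p.base ∈ U}
  target := {z | f z.1 ∈ U}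
  map_source' p hp := hp
  map_target' z hz := by
    have hz' : f z.1 ∈ U := hz
    rw [trivInv_of_mem he p₀ hz']
    exact hz'
  left_inv' p hp := by
    have hp' : f p.base ∈ U := hp
    rw [trivInv_of_mem he p₀ (z := (p.base, (e p.total).2)) hp']
    refine PullbackBundle.ext rfl ?_
    change e.symm (f p.base, (e p.total).2) = p.total
    rw [p.base_total] at hp' ⊢
    exact he.symm_apply hp'
  right_inv' z hz := by
    have hz' : f z.1 ∈ U := hz
    rw [trivInv_of_mem he p₀ hz']
    refine Prod.ext rfl ?_
    change (e (e.symm (f z.1, z.2))).2 = z.2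
    rw [e.right_inv (he.mem_target.2 hz')]
  open_source := he.isOpen.preimage (f.contMDiff.continuous.comp continuous_base)
  open_target := he.isOpen.preimage (f.contMDiff.continuous.comp continuous_fst)
  continuousOn_toFun := by
    refine continuous_base.continuousOn.prodMk ?_
    refine continuous_snd.comp_continuousOn
      (e.continuousOn.comp continuous_total.continuousOn fun p hp ↦ he.mem_source.2 ?_)
    rw [← p.base_total]; exact hp
  continuousOn_invFun := by
    refine isInducing.continuousOn_iff.2 ?_
    have : ContinuousOn (fun z : X × K ↦ (z.1, e.symm (f z.1, z.2))) {z | f z.1 ∈ U} := by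
      refine continuous_fst.continuousOn.prodMk (e.continuousOn_symm.comp
        ((f.contMDiff.continuous.comp continuous_fst).prodMk continuous_snd).continuousOn
        fun z hz ↦ he.mem_target.2 hz)
    refine this.congr fun z hz ↦ ?_
    simp only [Function.comp, trivInv_of_mem he p₀ (z := z) hz]

lemma triv_apply (he : IsLocalTriv IM IQ IK B.proj U e) (p₀ p : PullbackBundle f B) :
    triv he p₀ p = (p.base, (e p.total).2) := rfl

lemma mem_triv_source (he : IsLocalTriv IM IQ IK B.proj U e) (p₀ p : PullbackBundle f B) :
    p ∈ (triv he p₀).source ↔ f p.base ∈ U := Iff.rfl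

lemma mem_triv_target (he : IsLocalTriv IM IQ IK B.proj U e) (p₀ : PullbackBundle f B)
    (z : X × K) : z ∈ (triv he p₀).target ↔ f z.1 ∈ U := Iff.rfl

lemma triv_symm_apply (he : IsLocalTriv IM IQ IK B.proj U e) (p₀ : PullbackBundle f B)
    {z : X × K} (hz : f z.1 ∈ U) :
    (triv he p₀).symm z = ⟨z.1, e.symm (f z.1, z.2), (he.proj_symm hz z.2).symm⟩ :=
  trivInv_of_mem he p₀ hz

/-- The transition functions are smooth. -/
lemma contMDiffOn_transition (he : IsLocalTriv IM IQ IK B.proj U e)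
    (he' : IsLocalTriv IM IQ IK B.proj V e') (p₀ p₁ : PullbackBundle f B) :
    ContMDiffOn (IX.prod IK) (IX.prod IK) ∞ (triv he' p₁ ∘ (triv he p₀).symm)
      {z | f z.1 ∈ U ∩ V} := by
  have h1 : ContMDiffOn (IX.prod IK) IQ ∞ (fun z : X × K ↦ e.symm (f z.1, z.2))
      {z | f z.1 ∈ U ∩ V} :=
    he.contMDiffOn_symm.comp
      ((f.contMDiff.comp contMDiff_fst).prodMk contMDiff_snd).contMDiffOn
      fun z hz ↦ he.mem_target.2 hz.1
  have h2 : ContMDiffOn (IX.prod IK) (IM.prod IK) ∞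
      (fun z : X × K ↦ e' (e.symm (f z.1, z.2))) {z | f z.1 ∈ U ∩ V} := by
    refine he'.contMDiffOn.comp h1 fun z hz ↦ he'.mem_source.2 ?_
    rw [he.proj_symm hz.1]
    exact hz.2
  refine (contMDiff_fst.contMDiffOn.prodMk (contMDiff_snd.comp_contMDiffOn h2)).congr
    fun z hz ↦ ?_
  simp only [Function.comp, triv_apply, triv_symm_apply he p₀ hz.1]

/-- An open set of `M` around `f x` over which `Q` is trivial. -/
def trivSet (p : PullbackBundle f B) : Set M := (B.exists_triv (f p.base)).choose

/-- A trivialization of `Q` over `trivSet p`. -/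
def baseTriv (p : PullbackBundle f B) : OpenPartialHomeomorph Q (M × K) :=
  (B.exists_triv (f p.base)).choose_spec.choose

lemma mem_trivSet (p : PullbackBundle f B) : f p.base ∈ trivSet p :=
  (B.exists_triv (f p.base)).choose_spec.choose_spec.1

lemma isLocalTriv_baseTriv (p : PullbackBundle f B) :
    IsLocalTriv IM IQ IK B.proj (trivSet p) (baseTriv p) :=
  (B.exists_triv (f p.base)).choose_spec.choose_spec.2

/-- A trivialization of `f^*Q` around the point `p`. -/
def trivAt (p : PullbackBundle f B) : OpenPartialHomeomorph (PullbackBundle f B) (X × K) :=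
  triv (isLocalTriv_baseTriv p) p

lemma mem_trivAt_source (p : PullbackBundle f B) : p ∈ (trivAt p).source := mem_trivSet p

/-- The manifold structure on `f^*Q`: the charts are the trivializations of `f^*Q` followed by
the charts of `X × K`. -/
instance : ChartedSpace (ModelProd HX HK) (PullbackBundle f B) where
  atlas := Set.range fun p : PullbackBundle f B × (X × K) ↦
    trivAt p.1 ≫ₕ chartAt (ModelProd HX HK) p.2
  chartAt p := trivAt p ≫ₕ chartAt (ModelProd HX HK) (trivAt p p)
  mem_chart_source p := by
    rw [OpenPartialHomeomorph.trans_source]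
    exact ⟨mem_trivAt_source p, mem_chart_source (ModelProd HX HK) (trivAt p p)⟩
  chart_mem_atlas p := ⟨(p, trivAt p p), rfl⟩

lemma chartAt_eq (p : PullbackBundle f B) : chartAt (ModelProd HX HK) p =
    trivAt p ≫ₕ chartAt (ModelProd HX HK) (trivAt p p) := rfl

variable [IsManifold IX ∞ X] [LieGroup IK ∞ K]

instance : IsManifold (IX.prod IK) ∞ (PullbackBundle f B) := by
  refine isManifold_of_contDiffOn _ _ _ ?_
  rintro _ _ ⟨⟨p₀, z₀⟩, rfl⟩ ⟨⟨p₁, z₁⟩, rfl⟩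
  rw [← contMDiffOn_iff_contDiffOn]
  have hT := contMDiffOn_transition (isLocalTriv_baseTriv p₀) (isLocalTriv_baseTriv p₁) p₀ p₁
  have c0 := contMDiffOn_chart_symm (I := IX.prod IK) (n := ∞) (H := ModelProd HX HK) (x := z₀)
  have c1 := contMDiffOn_chart (I := IX.prod IK) (n := ∞) (H := ModelProd HX HK) (x := z₁)
  apply (IX.prod IK).contMDiff.comp_contMDiffOn
  have hI := (IX.prod IK).contMDiffOn_symm (n := ∞)
  have hsub : ∀ y ∈ (IX.prod IK).symm ⁻¹' ((trivAt p₀ ≫ₕ chartAt (ModelProd HX HK) z₀).symm ≫ₕ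
      trivAt p₁ ≫ₕ chartAt (ModelProd HX HK) z₁).source ∩ Set.range (IX.prod IK),
      y ∈ Set.range (IX.prod IK) ∧
      (IX.prod IK).symm y ∈ (chartAt (ModelProd HX HK) z₀).target ∧
      (chartAt (ModelProd HX HK) z₀).symm ((IX.prod IK).symm y) ∈
        {z | f z.1 ∈ trivSet p₀ ∩ trivSet p₁} ∧
      (trivAt p₁ ∘ (trivAt p₀).symm) ((chartAt (ModelProd HX HK) z₀).symm ((IX.prod IK).symm y)) ∈
        (chartAt (ModelProd HX HK) z₁).source := by
    rintro y ⟨hy, hr⟩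
    simp only [Set.mem_preimage, OpenPartialHomeomorph.trans_source,
      OpenPartialHomeomorph.symm_source, OpenPartialHomeomorph.trans_target, Set.mem_inter_iff,
      OpenPartialHomeomorph.coe_trans_symm, Function.comp] at hy
    obtain ⟨⟨h1, h2⟩, h3, h4⟩ := hy
    have h2' : f ((chartAt (ModelProd HX HK) z₀).symm ((IX.prod IK).symm y)).1 ∈ trivSet p₀ := h2
    refine ⟨hr, h1, ⟨h2', ?_⟩, h4⟩
    have h5 := (mem_triv_source (isLocalTriv_baseTriv p₁) p₁ _).1 h3
    change f ((triv (isLocalTriv_baseTriv p₀) p₀).symm _).base ∈ _ at h5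
    rw [triv_symm_apply (isLocalTriv_baseTriv p₀) p₀ h2'] at h5
    exact h5
  exact c1.comp (hT.comp (c0.comp (hI.mono fun y hy ↦ (hsub y hy).1) fun y hy ↦ (hsub y hy).2.1)
    fun y hy ↦ (hsub y hy).2.2.1) fun y hy ↦ (hsub y hy).2.2.2

lemma contMDiffAt_trivAt (p : PullbackBundle f B) :
    ContMDiffAt (IX.prod IK) (IX.prod IK) ∞ (trivAt p) p := by
  have hc : ContMDiffAt (IX.prod IK) (IX.prod IK) ∞ (chartAt (ModelProd HX HK) p) p :=
    contMDiffOn_chart.contMDiffAt ((chartAt (ModelProd HX HK) p).open_source.mem_nhds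
      (mem_chart_source _ p))
  have hs : ContMDiffAt (IX.prod IK) (IX.prod IK) ∞
      (chartAt (ModelProd HX HK) (trivAt p p)).symm (chartAt (ModelProd HX HK) p p) :=
    contMDiffOn_chart_symm.contMDiffAt
      ((chartAt (ModelProd HX HK) (trivAt p p)).open_target.mem_nhds
        (mem_chart_target _ (trivAt p p)))
  refine (hs.comp p hc).congr_of_eventuallyEq ?_
  filter_upwards [(chartAt (ModelProd HX HK) p).open_source.mem_nhds (mem_chart_source _ p)]
    with y hy
  exact ((chartAt (ModelProd HX HK) (trivAt p p)).left_inv hy.2).symm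

lemma contMDiffAt_trivAt_symm (p : PullbackBundle f B) :
    ContMDiffAt (IX.prod IK) (IX.prod IK) ∞ (trivAt p).symm (trivAt p p) := by
  have hc : ContMDiffAt (IX.prod IK) (IX.prod IK) ∞
      (chartAt (ModelProd HX HK) (trivAt p p)) (trivAt p p) :=
    contMDiffOn_chart.contMDiffAt ((chartAt (ModelProd HX HK) (trivAt p p)).open_source.mem_nhds
      (mem_chart_source _ _))
  have hs : ContMDiffAt (IX.prod IK) (IX.prod IK) ∞
      (chartAt (ModelProd HX HK) p).symm (chartAt (ModelProd HX HK) (trivAt p p) (trivAt p p)) :=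
    contMDiffOn_chart_symm.contMDiffAt
      ((chartAt (ModelProd HX HK) p).open_target.mem_nhds (mem_chart_target _ p))
  refine (hs.comp (trivAt p p) hc).congr_of_eventuallyEq ?_
  filter_upwards [(chartAt (ModelProd HX HK) (trivAt p p)).open_source.mem_nhds
    (mem_chart_source _ _)] with y hy
  change _ = (trivAt p).symm ((chartAt (ModelProd HX HK) (trivAt p p)).symm _)
  rw [(chartAt (ModelProd HX HK) (trivAt p p)).left_inv hy]

lemma contMDiff_base : ContMDiff (IX.prod IK) IX ∞ (base : PullbackBundle f B → X) :=
  fun p ↦ (contMDiffAt_trivAt p).fst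

lemma contMDiff_total : ContMDiff (IX.prod IK) IQ ∞ (total : PullbackBundle f B → Q) := by
  intro p
  have he := isLocalTriv_baseTriv p
  have h1 : ContMDiffAt (IX.prod IK) (IM.prod IK) ∞
      (fun y : PullbackBundle f B ↦ (f y.base, ((baseTriv p) y.total).2)) p :=
    (f.contMDiff.contMDiffAt.comp p (contMDiff_base p)).prodMk (contMDiffAt_trivAt p).snd
  have h2 : ContMDiffAt (IM.prod IK) IQ ∞ (baseTriv p).symm
      (f p.base, ((baseTriv p) p.total).2) :=
    he.contMDiffOn_symm.contMDiffAt
      ((baseTriv p).open_target.mem_nhds (he.mem_target.2 (mem_trivSet p)))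
  refine (h2.comp p h1).congr_of_eventuallyEq ?_
  filter_upwards [(trivAt p).open_source.mem_nhds (mem_trivAt_source p)] with y hy
  have hy' : f y.base ∈ trivSet p := hy
  simp only [Function.comp, y.base_total] at hy' ⊢
  exact (he.symm_apply hy').symm

section

variable {EY HY Y : Type*} [NormedAddCommGroup EY] [NormedSpace ℝ EY]
  [TopologicalSpace HY] [TopologicalSpace Y] [ChartedSpace HY Y] {IY : ModelWithCorners ℝ EY HY}

/-- A map to `f^*Q` is smooth if its two components are. -/
lemma contMDiffAt_of_comp {h : Y → PullbackBundle f B} {y : Y}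
    (hb : ContMDiffAt IY IX ∞ (fun y ↦ (h y).base) y)
    (ht : ContMDiffAt IY IQ ∞ (fun y ↦ (h y).total) y) : ContMDiffAt IY (IX.prod IK) ∞ h y := by
  have he := isLocalTriv_baseTriv (h y)
  have hy : (h y).total ∈ (baseTriv (h y)).source :=
    he.mem_source.2 (by rw [← base_total]; exact mem_trivSet _)
  have h1 : ContMDiffAt IQ (IM.prod IK) ∞ (baseTriv (h y)) (h y).total :=
    he.contMDiffOn.contMDiffAt ((baseTriv (h y)).open_source.mem_nhds hy)
  have h2 : ContMDiffAt IY (IX.prod IK) ∞ (fun w ↦ trivAt (h y) (h w)) y :=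
    hb.prodMk (h1.comp y ht).snd
  refine ((contMDiffAt_trivAt_symm (h y)).comp y h2).congr_of_eventuallyEq ?_
  have hcont : ContinuousAt h y :=
    isInducing.continuousAt_iff.2 (hb.continuousAt.prodMk ht.continuousAt)
  filter_upwards [hcont.preimage_mem_nhds
    ((trivAt (h y)).open_source.mem_nhds (mem_trivAt_source (h y)))] with w hw
  exact ((trivAt (h y)).left_inv hw).symm

lemma contMDiff_of_comp {h : Y → PullbackBundle f B} (hb : ContMDiff IY IX ∞ fun y ↦ (h y).base)
    (ht : ContMDiff IY IQ ∞ fun y ↦ (h y).total) : ContMDiff IY (IX.prod IK) ∞ h :=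
  fun y ↦ contMDiffAt_of_comp (hb y) (ht y)

end

lemma isLocalTriv_triv (he : IsLocalTriv IM IQ IK B.proj U e) (p₀ : PullbackBundle f B) :
    IsLocalTriv IX (IX.prod IK) IK (base : PullbackBundle f B → X) (f ⁻¹' U) (triv he p₀) where
  isOpen := he.isOpen.preimage f.contMDiff.continuous
  source_eq := rfl
  target_eq := by ext z; simp [mem_triv_target]
  fst_apply _ _ := rfl
  apply_act p hp k := by
    have hp' : p.total ∈ e.source := he.mem_source.2 (by rw [← base_total]; exact hp)
    refine Prod.ext rfl ?_
    exact (congrArg Prod.snd (he.apply_act p.total hp' k) :)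
  contMDiffOn := by
    have h1 : ContMDiffOn (IX.prod IK) (IM.prod IK) ∞
        (fun p : PullbackBundle f B ↦ e p.total) (triv he p₀).source :=
      he.contMDiffOn.comp contMDiff_total.contMDiffOn
        fun p hp ↦ he.mem_source.2 (by rw [← base_total]; exact hp)
    exact contMDiff_base.contMDiffOn.prodMk (contMDiff_snd.comp_contMDiffOn h1)
  contMDiffOn_symm := by
    intro z hz
    have h1 : ContMDiffAt (IX.prod IK) (IM.prod IK) ∞ (fun z : X × K ↦ (f z.1, z.2)) z :=
      ((f.contMDiff.comp contMDiff_fst).prodMk contMDiff_snd).contMDiffAt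
    have h2 : ContMDiffAt (IM.prod IK) IQ ∞ e.symm (f z.1, z.2) :=
      he.contMDiffOn_symm.contMDiffAt (e.open_target.mem_nhds (he.mem_target.2 hz))
    have hev : ∀ᶠ w in nhds z, f w.1 ∈ U := (triv he p₀).open_target.mem_nhds hz
    refine (contMDiffAt_of_comp ?_ ?_).contMDiffWithinAt
    · refine contMDiffAt_fst.congr_of_eventuallyEq ?_
      filter_upwards [hev] with w hw
      rw [triv_symm_apply he p₀ hw]
    · refine (h2.comp z h1).congr_of_eventuallyEq ?_
      filter_upwards [hev] with w hw
      rw [triv_symm_apply he p₀ hw]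
      rfl

end PullbackBundle

/-- The pullback `f^*Q → X`, as a smooth principal `K`-bundle. -/
def SmoothPrincipalBundle.pullback [IsManifold IX ∞ X] [LieGroup IK ∞ K] (f : C^∞⟮IX, X; IM, M⟯)
    (B : SmoothPrincipalBundle IM IQ IK M Q K) :
    SmoothPrincipalBundle IX (IX.prod IK) IK X (PullbackBundle f B) K where
  proj := PullbackBundle.base
  contMDiff_act := by
    have hb : ContMDiff ((IX.prod IK).prod IK) IX ∞ (fun p : PullbackBundle f B × K ↦ p.1.base) :=
      PullbackBundle.contMDiff_base.comp contMDiff_fst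
    have ht : ContMDiff ((IX.prod IK).prod IK) IQ ∞
        (fun p : PullbackBundle f B × K ↦ MulOpposite.op p.2 • p.1.total) :=
      B.contMDiff_act.comp
        ((PullbackBundle.contMDiff_total.comp contMDiff_fst).prodMk contMDiff_snd)
    exact PullbackBundle.contMDiff_of_comp hb ht
  proj_act _ _ := rfl
  exists_triv x := by
    obtain ⟨U, e, hU, he⟩ := B.exists_triv (f x)
    exact ⟨f ⁻¹' U, PullbackBundle.triv he ⟨x, e.symm (f x, 1), (he.proj_symm hU 1).symm⟩, hU,
      PullbackBundle.isLocalTriv_triv he _⟩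

end Bundle

section Forms

variable {E H X E' H' Y : Type*} [NormedAddCommGroup E] [NormedSpace ℝ E] [TopologicalSpace H]
  [TopologicalSpace X] [ChartedSpace H X]
  [NormedAddCommGroup E'] [NormedSpace ℝ E'] [TopologicalSpace H']
  [TopologicalSpace Y] [ChartedSpace H' Y]
  {V : Type*} [AddCommGroup V] [Module ℝ V] [TopologicalSpace V]

/-- `V`-valued differential 1-forms on `X` (smoothness is imposed separately). -/
abbrev VectorOneForm (I : ModelWithCorners ℝ E H) (X : Type*) [TopologicalSpace X]
    [ChartedSpace H X] (V : Type*) [AddCommGroup V] [Module ℝ V] [TopologicalSpace V] : Type _ :=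
  ∀ x : X, TangentSpace I x →L[ℝ] V

/-- The pullback `φ^*η` of a 1-form along a (smooth) map `φ`. -/
def VectorOneForm.pullback (I : ModelWithCorners ℝ E H) (I' : ModelWithCorners ℝ E' H')
    (φ : X → Y) (η : VectorOneForm I' Y V) : VectorOneForm I X V :=
  fun x ↦ (η (φ x)).comp (mfderiv I I' φ x)

end Forms

section LieForms

variable {EG HG G : Type*} [NormedAddCommGroup EG] [NormedSpace ℝ EG] [TopologicalSpace HG]
  (IG : ModelWithCorners ℝ EG HG) [TopologicalSpace G] [ChartedSpace HG G] [Group G]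

/-- The adjoint representation: `Ad_g` is the derivative at `1` of `h ↦ g h g⁻¹`. -/
def lieAd (g : G) : GroupLieAlgebra IG G →L[ℝ] GroupLieAlgebra IG G :=
  (mfderiv IG IG (fun h : G ↦ g * h * g⁻¹) 1 : EG →L[ℝ] EG)

/-- The Maurer–Cartan form `θ ∈ Ω¹(G; 𝔤)`, `θ_g(v) = g⁻¹ v ∈ T_1 G`. -/
def maurerCartan (G : Type*) [TopologicalSpace G] [ChartedSpace HG G] [Group G] :
    VectorOneForm IG G (GroupLieAlgebra IG G) :=
  fun g ↦ (mfderiv IG IG (fun h : G ↦ g⁻¹ * h) g : EG →L[ℝ] EG)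

end LieForms

section Connections

variable {EM HM M EQ HQ Q EK HK K EX HX X EG HG G : Type*}
  [NormedAddCommGroup EM] [NormedSpace ℝ EM] [TopologicalSpace HM]
  [TopologicalSpace M] [ChartedSpace HM M]
  [NormedAddCommGroup EQ] [NormedSpace ℝ EQ] [TopologicalSpace HQ]
  [TopologicalSpace Q] [ChartedSpace HQ Q]
  [NormedAddCommGroup EK] [NormedSpace ℝ EK] [TopologicalSpace HK]
  [TopologicalSpace K] [ChartedSpace HK K] [Group K]
  [NormedAddCommGroup EX] [NormedSpace ℝ EX] [TopologicalSpace HX]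
  [TopologicalSpace X] [ChartedSpace HX X]
  [NormedAddCommGroup EG] [NormedSpace ℝ EG] [TopologicalSpace HG]
  [TopologicalSpace G] [ChartedSpace HG G] [Group G]
  {IM : ModelWithCorners ℝ EM HM} {IQ : ModelWithCorners ℝ EQ HQ}
  {IK : ModelWithCorners ℝ EK HK} {IX : ModelWithCorners ℝ EX HX}
  {IG : ModelWithCorners ℝ EG HG}
  [MulAction Kᵐᵒᵖ Q]

/-- A connection on a principal `K`-bundle `Q → M`: a smooth `𝔨`-valued 1-form `Θ` on `Q` which
reproduces the generators of the vertical vector fields and is `K`-equivariant. -/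
structure PrincipalConnection [IsManifold IQ ∞ Q] [LieGroup IK ∞ K] [FiniteDimensional ℝ EK]
    [BoundarylessManifold IK K] [T2Space K] (B : SmoothPrincipalBundle IM IQ IK M Q K) where
  form : VectorOneForm IQ Q (GroupLieAlgebra IK K)
  smooth : ContMDiff (M' := EK) IQ.tangent 𝓘(ℝ, EK) ∞
    (fun v : TangentBundle IQ Q ↦ form v.1 v.2)
  vertical : ∀ (A : GroupLieAlgebra IK K) (q : Q), form q (rightVectorField IQ A q) = A
  equivariant : ∀ (k : K) (q : Q) (v : TangentSpace IQ q),
    form (MulOpposite.op k • q) (mfderiv IQ IQ (fun y : Q ↦ MulOpposite.op k • y) q v) =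
      lieAd IK k⁻¹ (form q v)

section Invariance

variable [IsManifold IQ ∞ Q] [LieGroup IK ∞ K] [FiniteDimensional ℝ EK]
  [BoundarylessManifold IK K] [T2Space K] {B : SmoothPrincipalBundle IM IQ IK M Q K}

/-- `Θ` is `G`-invariant: `g^*Θ = Θ` for all `g`. -/
def PrincipalConnection.IsInvariant (G : Type*) [Group G] [MulAction G Q]
    (Θ : PrincipalConnection B) : Prop :=
  ∀ g : G, VectorOneForm.pullback IQ IQ (fun q : Q ↦ g • q) Θ.form = Θ.form

/-- `Θ` is `G`-basic: it is `G`-invariant and `ι_{ρ(A)} Θ = 0` for all `A ∈ 𝔤`. -/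
def PrincipalConnection.IsBasic (IG : ModelWithCorners ℝ EG HG) (G : Type*) [TopologicalSpace G]
    [ChartedSpace HG G] [Group G] [LieGroup IG ∞ G] [FiniteDimensional ℝ EG]
    [BoundarylessManifold IG G] [T2Space G] [MulAction G Q] (Θ : PrincipalConnection B) : Prop :=
  Θ.IsInvariant G ∧
    ∀ (A : GroupLieAlgebra IG G) (q : Q), Θ.form q (leftVectorField IQ A q) = 0

end Invariance

section Contraction

variable {V : Type*} [AddCommGroup V] [Module ℝ V] [TopologicalSpace V]

/-- The pullback `f^*η` to `f^*Q` of a 1-form `η` on `Q`. For a connection `Θ` on `Q` this is the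
pulled back connection `f^*Θ`. -/
def bundlePullback (f : C^∞⟮IX, X; IM, M⟯) (B : SmoothPrincipalBundle IM IQ IK M Q K)
    (η : VectorOneForm IQ Q V) : VectorOneForm (IX.prod IK) (PullbackBundle f B) V :=
  VectorOneForm.pullback (IX.prod IK) IQ PullbackBundle.total η

variable [LieGroup IG ∞ G] [FiniteDimensional ℝ EG] [BoundarylessManifold IG G] [T2Space G]
  [MulAction G Q] [ContMDiffSMul IG IQ ∞ G Q]

/-- The form `ι_{ρ(α)} f^*η` for `α ∈ Ω¹(X; 𝔤)`. At a point `(x, q)` of `f^*Q` it sends a tangent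
vector `w`, with image `v` in `T_x X`, to `η(ρ_q(α(v)))`. A 1-form on `X` with values in the
adjoint bundle of `f^*Q` is regarded here as a horizontal, `K`-equivariant 1-form on `f^*Q`. -/
def contractedPullback (f : C^∞⟮IX, X; IM, M⟯) (B : SmoothPrincipalBundle IM IQ IK M Q K)
    (α : VectorOneForm IX X (GroupLieAlgebra IG G)) (η : VectorOneForm IQ Q V) :
    VectorOneForm (IX.prod IK) (PullbackBundle f B) V :=
  fun p ↦ ((η p.total).comp (leftVectorFieldL IG p.total)).comp
    ((α p.base).comp (mfderiv (IX.prod IK) IX PullbackBundle.base p))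

end Contraction

section Action

/-- The face map `d₀(g, m) = m`. -/
def faceZero (IG : ModelWithCorners ℝ EG HG) (IM : ModelWithCorners ℝ EM HM) (G M : Type*)
    [TopologicalSpace G] [ChartedSpace HG G] [TopologicalSpace M] [ChartedSpace HM M] :
    C^∞⟮IG.prod IM, G × M; IM, M⟯ := ⟨Prod.snd, contMDiff_snd⟩

/-- The face map `d₁(g, m) = g m`. -/
def faceOne (IG : ModelWithCorners ℝ EG HG) (IM : ModelWithCorners ℝ EM HM) (G M : Type*)
    [TopologicalSpace G] [ChartedSpace HG G] [TopologicalSpace M] [ChartedSpace HM M]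
    [Group G] [MulAction G M] [ContMDiffSMul IG IM ∞ G M] :
    C^∞⟮IG.prod IM, G × M; IM, M⟯ :=
  ⟨fun p ↦ p.1 • p.2, contMDiff_smul (I := IG) (I' := IM)⟩

variable (IG)
variable [LieGroup IG ∞ G] [MulAction G M] [ContMDiffSMul IG IM ∞ G M]
variable [IsManifold IM ∞ M] [LieGroup IK ∞ K] [MulAction G Q] [ContMDiffSMul IG IQ ∞ G Q]
  (B : SmoothPrincipalBundle IM IQ IK M Q K)

/-- The bundle isomorphism `Ψ : d₀^*Q → d₁^*Q`, `Ψ(g, m, q) = (g, m, g q)`, given by the action of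
`G` on `Q`. -/
def actionIso (hB : ∀ (g : G) (q : Q), B.proj (g • q) = g • B.proj q) :
    PullbackBundle (faceZero IG IM G M) B
      ≃ₘ⟮(IG.prod IM).prod IK, (IG.prod IM).prod IK⟯ PullbackBundle (faceOne IG IM G M) B where
  toFun p := ⟨p.base, p.base.1 • p.total, by
    rw [hB, ← p.base_total]; rfl⟩
  invFun p := ⟨p.base, p.base.1⁻¹ • p.total, by
    rw [hB, ← p.base_total]; exact (inv_smul_smul p.base.1 p.base.2).symm⟩
  left_inv p := PullbackBundle.ext rfl (inv_smul_smul _ _)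
  right_inv p := PullbackBundle.ext rfl (smul_inv_smul _ _)
  contMDiff_toFun := PullbackBundle.contMDiff_of_comp PullbackBundle.contMDiff_base
    ((contMDiff_smul (I := IG) (I' := IQ) (n := ∞) (G := G) (M := Q)).comp
      ((contMDiff_fst.comp PullbackBundle.contMDiff_base).prodMk PullbackBundle.contMDiff_total))
  contMDiff_invFun := PullbackBundle.contMDiff_of_comp PullbackBundle.contMDiff_base
    ((contMDiff_smul (I := IG) (I' := IQ) (n := ∞) (G := G) (M := Q)).comp
      (((contMDiff_inv IG ∞).comp (contMDiff_fst.comp PullbackBundle.contMDiff_base)).prodMk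
        PullbackBundle.contMDiff_total))

lemma actionIso_base (hB : ∀ (g : G) (q : Q), B.proj (g • q) = g • B.proj q)
    (p : PullbackBundle (faceZero IG IM G M) B) : (actionIso IG B hB p).base = p.base := rfl

lemma actionIso_total (hB : ∀ (g : G) (q : Q), B.proj (g • q) = g • B.proj q)
    (p : PullbackBundle (faceZero IG IM G M) B) :
    (actionIso IG B hB p).total = p.base.1 • p.total := rfl

/-- `Ψ` is a morphism of `K`-bundles, because the actions of `G` and `K` on `Q` commute. -/
lemma actionIso_act [SMulCommClass G Kᵐᵒᵖ Q]
    (hB : ∀ (g : G) (q : Q), B.proj (g • q) = g • B.proj q)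
    (k : Kᵐᵒᵖ) (p : PullbackBundle (faceZero IG IM G M) B) :
    actionIso IG B hB (k • p) = k • actionIso IG B hB p :=
  PullbackBundle.ext rfl (smul_comm p.base.1 k p.total)

end Action

end Connections

end

/-! ### Derivatives of the group action on `Q` -/

section ActionDerivative

variable {EQ HQ Q EG HG G : Type*}
  [NormedAddCommGroup EQ] [NormedSpace ℝ EQ] [TopologicalSpace HQ]
  {IQ : ModelWithCorners ℝ EQ HQ} [TopologicalSpace Q] [ChartedSpace HQ Q]
  [NormedAddCommGroup EG] [NormedSpace ℝ EG] [TopologicalSpace HG]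
  {IG : ModelWithCorners ℝ EG HG} [TopologicalSpace G] [ChartedSpace HG G]
  [Group G] [MulAction G Q]

/-! Both parts follow from one formula. Write θ for the Maurer–Cartan form. The composite of `Ψ`
with the map `d₁^*Q → Q` is (g, m, q) ↦ gq. By the product rule, its derivative on a tangent vector
w is (g·)_*(u - ρ_q(θ(v))), where u is the image of w in T_q Q and v its image in T(G × M). The
minus sign comes from e^{-tA} in the definition of ρ: differentiating h ↦ hq at 1 gives -ρ_q. Hence,
for every 1-form η on `Q`, (Ψ^*d₁^*η)(w) = (g^*η)_q(u - ρ_q(θ(v))), which is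
`pullback_actionIso_apply`; the product rule itself is `mfderiv_smul_apply`.

If g^*Θ = Θ, the right-hand side is Θ(u) - Θ(ρ_q(θ(v))), the form asserted in part 1. Conversely,
the asserted identity says that g^*Θ and Θ agree on all vectors u - ρ_q(θ(v)). These exhaust T_q Q
for each g: lifting u along the section q ↦ (g, π q, q) gives a w with θ(v) = 0
(`exists_tangent_faceZeroLift`).

For part 2, invariance and part 1 reduce Ψ^*d₁^*Θ = d₀^*Θ to the vanishing of Θ(ρ_q(θ(v))) for all
w. Every A in the Lie algebra of `G` occurs as θ(v), already over g = 1
(`exists_tangent_maurerCartan`), so this means that Θ(ρ(A)) = 0 for all A. -/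

lemma contMDiff_smul_left (IG : ModelWithCorners ℝ EG HG) [ContMDiffSMul IG IQ ∞ G Q] (g : G) :
    ContMDiff IQ IQ ∞ (fun q : Q ↦ g • q) :=
  (contMDiff_smul (I := IG) (I' := IQ) (n := ∞) (G := G) (M := Q)).comp
    (contMDiff_const.prodMk contMDiff_id)

lemma maurerCartan_one (A : GroupLieAlgebra IG G) : maurerCartan IG G 1 A = A := by
  -- The map h ↦ 1⁻¹ * h equals `id` only propositionally. Quantifying over f lets the substitution
  -- take place inside `mfderiv`, whose type depends on the map.
  have hid : ∀ f : G → G, f = id → (mfderiv IG IG f 1 : EG →L[ℝ] EG) A = A := by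
    rintro _ rfl
    rw [mfderiv_id]
    rfl
  exact hid _ (by funext x; simp)

variable [ContMDiffSMul IG IQ ∞ G Q]

lemma contMDiff_smul_right (q : Q) : ContMDiff IG IQ ∞ (fun g : G ↦ g • q) :=
  (contMDiff_smul (I := IG) (I' := IQ) (n := ∞) (G := G) (M := Q)).comp
    (contMDiff_id.prodMk contMDiff_const)

variable [LieGroup IG ∞ G] [FiniteDimensional ℝ EG] [BoundarylessManifold IG G] [T2Space G]

/-- The derivative of an orbit map, in terms of the Maurer–Cartan form. -/
lemma mfderiv_smul_right (g : G) (q : Q) (v : TangentSpace IG g) :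
    (mfderiv IG IQ (fun h : G ↦ h • q) g : EG →L[ℝ] EQ) v =
      -(mfderiv IQ IQ (fun y : Q ↦ g • y) q : EQ →L[ℝ] EQ)
        (leftVectorField IQ (maurerCartan IG G g v) q) := by
  have h1 : HasMFDerivAt IG IG (fun h : G ↦ g⁻¹ * h) g _ :=
    ((contMDiff_left_mul (IG := IG) g⁻¹).mdifferentiableAt (by simp)).hasMFDerivAt
  -- Factor the orbit map as h ↦ g • ((g⁻¹ * h) • q), so that its inner derivative at g is θ_g. The
  -- chain rule lands at g⁻¹ * g and (g⁻¹ * g) • q instead of 1 and q; the auxiliary point z in `h2`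
  -- and `h3` absorbs this discrepancy.
  have h2 : ∀ z : G, z = 1 → HasMFDerivAt IG IQ (fun h : G ↦ h • q) z
      (mfderiv IG IQ (fun h : G ↦ h • q) 1 : EG →L[ℝ] EQ) := by
    rintro _ rfl
    exact ((contMDiff_smul_right q).mdifferentiableAt (by simp)).hasMFDerivAt
  have h3 : ∀ z : Q, z = q → HasMFDerivAt IQ IQ (fun y : Q ↦ g • y) z
      (mfderiv IQ IQ (fun y : Q ↦ g • y) q : EQ →L[ℝ] EQ) := by
    rintro _ rfl
    exact ((contMDiff_smul_left IG g).mdifferentiableAt (by simp)).hasMFDerivAt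
  have h4 := (h3 ((g⁻¹ * g) • q) (by simp)).comp g ((h2 (g⁻¹ * g) (by simp)).comp g h1)
  have h5 : (fun y : Q ↦ g • y) ∘ (fun h : G ↦ h • q) ∘ (fun h : G ↦ g⁻¹ * h) =
      fun h : G ↦ h • q := by
    funext h
    simp [smul_smul]
  rw [h5] at h4
  rw [leftVectorField_eq]
  -- The sign in the statement cancels the one in ρ_q = -(derivative of the orbit map at 1).
  refine (DFunLike.congr_fun (F := EG →L[ℝ] EQ) h4.mfderiv v).trans ?_
  refine Eq.trans ?_ (congrArg Neg.neg
    ((mfderiv IQ IQ (fun y : Q ↦ g • y) q : EQ →L[ℝ] EQ).map_neg _)).symm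
  exact (neg_neg _).symm

variable {E H Y : Type*} [NormedAddCommGroup E] [NormedSpace ℝ E] [TopologicalSpace H]
  [TopologicalSpace Y] [ChartedSpace H Y] {I : ModelWithCorners ℝ E H}

/-- The derivative of `y ↦ a y • b y`. -/
lemma mfderiv_smul_apply {a : Y → G} {b : Y → Q} {y : Y} (ha : MDifferentiableAt I IG a y)
    (hb : MDifferentiableAt I IQ b y) (w : TangentSpace I y) :
    (mfderiv I IQ (fun z ↦ a z • b z) y : E →L[ℝ] EQ) w =
      (mfderiv IQ IQ (fun x : Q ↦ a y • x) (b y) : EQ →L[ℝ] EQ)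
        ((mfderiv I IQ b y : E →L[ℝ] EQ) w -
          leftVectorField IQ (maurerCartan IG G (a y) (mfderiv I IG a y w)) (b y)) := by
  have hs : MDifferentiableAt (IG.prod IQ) IQ (fun p : G × Q ↦ p.1 • p.2) (a y, b y) :=
    (contMDiff_smul (I := IG) (I' := IQ) (n := ∞) (G := G) (M := Q)).mdifferentiableAt (by simp)
  have h1 := (hs.hasMFDerivAt.comp y (ha.hasMFDerivAt.prodMk hb.hasMFDerivAt)).mfderiv
  refine (DFunLike.congr_fun (F := E →L[ℝ] EQ) h1 w).trans ?_
  -- The derivative of the action splits into its two partials: the `G`-partial is an orbit map, and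
  -- the `Q`-partial is translation by `a y`. Both are values of that same translation's derivative,
  -- so linearity merges them.
  refine (mfderiv_prod_eq_add_apply hs (v := ((mfderiv I IG a y w, mfderiv I IQ b y w) :
    EG × EQ))).trans ?_
  refine (congrArg (· + (mfderiv IQ IQ (fun x : Q ↦ a y • x) (b y) : EQ →L[ℝ] EQ)
    ((mfderiv I IQ b y : E →L[ℝ] EQ) w))
      (mfderiv_smul_right (IQ := IQ) (a y) (b y) (mfderiv I IG a y w))).trans ?_
  refine Eq.trans ?_ ((mfderiv IQ IQ (fun x : Q ↦ a y • x) (b y) : EQ →L[ℝ] EQ).map_sub _ _).symm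
  exact neg_add_eq_sub _ _

end ActionDerivative

/-! ### The form Ψ^*d₁^*η and test vectors on d₀^*Q -/

section FacePullbacks

variable {EM HM M EQ HQ Q EK HK K EG HG G : Type*}
  [NormedAddCommGroup EM] [NormedSpace ℝ EM] [TopologicalSpace HM]
  {IM : ModelWithCorners ℝ EM HM} [TopologicalSpace M] [ChartedSpace HM M] [IsManifold IM ∞ M]
  [NormedAddCommGroup EQ] [NormedSpace ℝ EQ] [TopologicalSpace HQ]
  {IQ : ModelWithCorners ℝ EQ HQ} [TopologicalSpace Q] [ChartedSpace HQ Q]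
  [NormedAddCommGroup EK] [NormedSpace ℝ EK] [TopologicalSpace HK]
  {IK : ModelWithCorners ℝ EK HK} [TopologicalSpace K] [ChartedSpace HK K]
  [Group K] [LieGroup IK ∞ K]
  [NormedAddCommGroup EG] [NormedSpace ℝ EG] [TopologicalSpace HG]
  {IG : ModelWithCorners ℝ EG HG} [TopologicalSpace G] [ChartedSpace HG G]
  [Group G] [LieGroup IG ∞ G]
  [MulAction Kᵐᵒᵖ Q] {V : Type*} [AddCommGroup V] [Module ℝ V] [TopologicalSpace V]
  (B : SmoothPrincipalBundle IM IQ IK M Q K)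

/-- The section `q ↦ (g, π q, q)` of the projection `d₀^*Q → Q`. -/
def faceZeroLift (g : G) (q : Q) : PullbackBundle (faceZero IG IM G M) B :=
  ⟨(g, B.proj q), q, rfl⟩

/-- Every tangent vector of `Q` lifts to a tangent vector of `d₀^*Q` at `(g, m, q)` whose component
along `G` vanishes. -/
lemma exists_tangent_faceZeroLift (g : G) (q : Q) (u : TangentSpace IQ q) :
    ∃ w : TangentSpace ((IG.prod IM).prod IK) (faceZeroLift (IG := IG) B g q),
      (mfderiv ((IG.prod IM).prod IK) IQ PullbackBundle.total (faceZeroLift (IG := IG) B g q) :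
        (EG × EM) × EK →L[ℝ] EQ) w = u ∧
      VectorOneForm.pullback (IG.prod IM) IG Prod.fst (maurerCartan IG G) (g, B.proj q)
        (mfderiv ((IG.prod IM).prod IK) (IG.prod IM) PullbackBundle.base
          (faceZeroLift (IG := IG) B g q) w) = 0 := by
  have hs : ContMDiff IQ ((IG.prod IM).prod IK) ∞ (faceZeroLift (IG := IG) B g) :=
    PullbackBundle.contMDiff_of_comp (contMDiff_const.prodMk B.contMDiff_proj) contMDiff_id
  have hs' := hs.mdifferentiableAt (x := q) (by simp)
  have hbase : MDifferentiableAt ((IG.prod IM).prod IK) (IG.prod IM)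
      (PullbackBundle.base (f := faceZero IG IM G M) (B := B)) (faceZeroLift B g q) :=
    PullbackBundle.contMDiff_base.mdifferentiableAt (by simp)
  have htotal : MDifferentiableAt ((IG.prod IM).prod IK) IQ
      (PullbackBundle.total (f := faceZero IG IM G M) (B := B)) (faceZeroLift B g q) :=
    PullbackBundle.contMDiff_total.mdifferentiableAt (by simp)
  have hfst : MDifferentiableAt (IG.prod IM) IG (Prod.fst : G × M → G)
    (faceZeroLift (IG := IG) B g q).base := mdifferentiableAt_fst
  -- Push u forward along the section: followed by `total` it is the identity of `Q`, and its
  -- `G`-component is constantly g.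
  refine ⟨mfderiv IQ ((IG.prod IM).prod IK) (faceZeroLift (IG := IG) B g) q u, ?_, ?_⟩
  · refine (DFunLike.congr_fun (F := EQ →L[ℝ] EQ) (mfderiv_comp q htotal hs') u).symm.trans ?_
    exact DFunLike.congr_fun (F := EQ →L[ℝ] EQ) (mfderiv_id (I := IQ) (x := q)) u
  · have h1 : (mfderiv (IG.prod IM) IG Prod.fst (g, B.proj q) : EG × EM →L[ℝ] EG)
        (mfderiv ((IG.prod IM).prod IK) (IG.prod IM) PullbackBundle.base
          (faceZeroLift (IG := IG) B g q)
          (mfderiv IQ ((IG.prod IM).prod IK) (faceZeroLift (IG := IG) B g) q u)) = (0 : EG) :=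
      (DFunLike.congr_fun (F := EQ →L[ℝ] EG)
        (((mfderiv_comp q hfst (hbase.comp q hs')).trans
          (congrArg (ContinuousLinearMap.comp (M₁ := EQ) (M₂ := EG × EM) (M₃ := EG) _)
            (mfderiv_comp q hbase hs')))) u).symm.trans
        (DFunLike.congr_fun (F := EQ →L[ℝ] EG) (mfderiv_const (I := IQ) (x := q) (c := g)) u)
    exact (congrArg (maurerCartan IG G g : EG →L[ℝ] EG) h1).trans
      (maurerCartan IG G g : EG →L[ℝ] EG).map_zero

/-- Every `A ∈ 𝔤` is the value of the Maurer–Cartan form on some tangent vector of `d₀^*Q` at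
`(1, m, q)`. -/
lemma exists_tangent_maurerCartan (q : Q) (A : GroupLieAlgebra IG G) :
    ∃ w : TangentSpace ((IG.prod IM).prod IK) (faceZeroLift (IG := IG) B (1 : G) q),
      VectorOneForm.pullback (IG.prod IM) IG Prod.fst (maurerCartan IG G) (1, B.proj q)
        (mfderiv ((IG.prod IM).prod IK) (IG.prod IM) PullbackBundle.base
          (faceZeroLift (IG := IG) B (1 : G) q) w) = A := by
  have hs : ContMDiff IG ((IG.prod IM).prod IK) ∞
      (fun g : G ↦ faceZeroLift (IG := IG) B g q) :=
    PullbackBundle.contMDiff_of_comp (contMDiff_id.prodMk contMDiff_const) contMDiff_const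
  have hs' := hs.mdifferentiableAt (x := 1) (by simp)
  have hbase : MDifferentiableAt ((IG.prod IM).prod IK) (IG.prod IM)
      (PullbackBundle.base (f := faceZero IG IM G M) (B := B)) (faceZeroLift B 1 q) :=
    PullbackBundle.contMDiff_base.mdifferentiableAt (by simp)
  have hfst : MDifferentiableAt (IG.prod IM) IG (Prod.fst : G × M → G)
    (faceZeroLift (IG := IG) B 1 q).base := mdifferentiableAt_fst
  -- Since d₀ ignores g, the point (g, π q, q) stays in d₀^*Q as g varies with q fixed. Moving g in
  -- direction A at 1 gives a vector with `G`-component A, and θ is the identity at 1.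
  refine ⟨mfderiv IG ((IG.prod IM).prod IK) (fun g : G ↦ faceZeroLift (IG := IG) B g q) 1 A, ?_⟩
  have h1 : (mfderiv (IG.prod IM) IG Prod.fst (1, B.proj q) : EG × EM →L[ℝ] EG)
      (mfderiv ((IG.prod IM).prod IK) (IG.prod IM) PullbackBundle.base
        (faceZeroLift (IG := IG) B 1 q)
        (mfderiv IG ((IG.prod IM).prod IK) (fun g : G ↦ faceZeroLift (IG := IG) B g q) 1 A)) =
      (A : EG) :=
    (DFunLike.congr_fun (F := EG →L[ℝ] EG)
      (((mfderiv_comp (1 : G) hfst (hbase.comp (1 : G) hs')).trans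
        (congrArg (ContinuousLinearMap.comp (M₁ := EG) (M₂ := EG × EM) (M₃ := EG) _)
          (mfderiv_comp (1 : G) hbase hs')))) A).symm.trans
      (DFunLike.congr_fun (F := EG →L[ℝ] EG) (mfderiv_id (I := IG) (x := (1 : G))) A)
  exact (congrArg (maurerCartan IG G 1 : EG →L[ℝ] EG) h1).trans (maurerCartan_one A)

variable [FiniteDimensional ℝ EG] [BoundarylessManifold IG G] [T2Space G]
  [MulAction G M] [ContMDiffSMul IG IM ∞ G M] [MulAction G Q] [ContMDiffSMul IG IQ ∞ G Q]

/-- `Ψ^*d₁^*η` at `p = (g, m, q)` is `g^*η` evaluated on the derivative of the projection to `Q`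
corrected by `ρ_q(θ)`. -/
lemma pullback_actionIso_apply (hB : ∀ (g : G) (q : Q), B.proj (g • q) = g • B.proj q)
    (η : VectorOneForm IQ Q V) (p : PullbackBundle (faceZero IG IM G M) B)
    (w : TangentSpace ((IG.prod IM).prod IK) p) :
    VectorOneForm.pullback ((IG.prod IM).prod IK) ((IG.prod IM).prod IK) (actionIso IG B hB)
        (bundlePullback (faceOne IG IM G M) B η) p w =
      VectorOneForm.pullback IQ IQ (fun q : Q ↦ p.base.1 • q) η p.total
        ((mfderiv ((IG.prod IM).prod IK) IQ PullbackBundle.total p : (EG × EM) × EK →L[ℝ] EQ) w -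
          leftVectorField IQ (VectorOneForm.pullback (IG.prod IM) IG Prod.fst (maurerCartan IG G)
            p.base (mfderiv ((IG.prod IM).prod IK) (IG.prod IM) PullbackBundle.base p w))
            p.total) := by
  have hbase : MDifferentiableAt ((IG.prod IM).prod IK) (IG.prod IM)
      (PullbackBundle.base (f := faceZero IG IM G M) (B := B)) p :=
    PullbackBundle.contMDiff_base.mdifferentiableAt (by simp)
  have htotal : MDifferentiableAt ((IG.prod IM).prod IK) IQ
      (PullbackBundle.total (f := faceZero IG IM G M) (B := B)) p :=
    PullbackBundle.contMDiff_total.mdifferentiableAt (by simp)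
  have hΨ : MDifferentiableAt ((IG.prod IM).prod IK) ((IG.prod IM).prod IK)
      (actionIso IG B hB) p :=
    (actionIso IG B hB).contMDiff.mdifferentiableAt (by simp)
  have htotal' : MDifferentiableAt ((IG.prod IM).prod IK) IQ
      (PullbackBundle.total (f := faceOne IG IM G M) (B := B)) (actionIso IG B hB p) :=
    PullbackBundle.contMDiff_total.mdifferentiableAt (by simp)
  have hfst : MDifferentiableAt (IG.prod IM) IG (Prod.fst : G × M → G) p.base :=
    mdifferentiableAt_fst
  -- `total` after Ψ is by definition z ↦ z.base.1 • z.total, so `h1` and `h2` evaluate the same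
  -- derivative; `h3` then splits the derivative of the `G`-component so that the pulled back θ
  -- appears.
  have h1 := DFunLike.congr_fun (F := (EG × EM) × EK →L[ℝ] EQ) (mfderiv_comp p htotal' hΨ) w
  have h2 := mfderiv_smul_apply (IG := IG) (IQ := IQ) (hfst.comp p hbase) htotal w
  have h3 := DFunLike.congr_fun (F := (EG × EM) × EK →L[ℝ] EG) (mfderiv_comp p hfst hbase) w
  refine (congrArg (η (p.base.1 • p.total)) (h1.symm.trans h2)).trans ?_
  refine congrArg (fun v : EG ↦ η (p.base.1 • p.total)
    ((mfderiv IQ IQ (fun x : Q ↦ p.base.1 • x) p.total : EQ →L[ℝ] EQ)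
      ((mfderiv ((IG.prod IM).prod IK) IQ PullbackBundle.total p : (EG × EM) × EK →L[ℝ] EQ) w -
        leftVectorField IQ ((maurerCartan IG G p.base.1 : EG →L[ℝ] EG) v) p.total))) h3

end FacePullbacks

/-! ### Criteria for invariant and basic connections -/

theorem proposition3p2
    {EM HM M EQ HQ Q EK HK K EG HG G : Type*}
    -- the base manifold `M`
    [NormedAddCommGroup EM] [NormedSpace ℝ EM] [FiniteDimensional ℝ EM] [TopologicalSpace HM]
    {IM : ModelWithCorners ℝ EM HM} [TopologicalSpace M] [ChartedSpace HM M]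
    [IsManifold IM ∞ M] [BoundarylessManifold IM M]
    -- the total space `Q`
    [NormedAddCommGroup EQ] [NormedSpace ℝ EQ] [FiniteDimensional ℝ EQ] [TopologicalSpace HQ]
    {IQ : ModelWithCorners ℝ EQ HQ} [TopologicalSpace Q] [ChartedSpace HQ Q]
    [IsManifold IQ ∞ Q] [BoundarylessManifold IQ Q]
    -- the structure group `K`
    [NormedAddCommGroup EK] [NormedSpace ℝ EK] [FiniteDimensional ℝ EK] [TopologicalSpace HK]
    {IK : ModelWithCorners ℝ EK HK} [TopologicalSpace K] [ChartedSpace HK K]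
    [BoundarylessManifold IK K] [T2Space K] [Group K] [LieGroup IK ∞ K]
    -- the symmetry group `G`
    [NormedAddCommGroup EG] [NormedSpace ℝ EG] [FiniteDimensional ℝ EG] [TopologicalSpace HG]
    {IG : ModelWithCorners ℝ EG HG} [TopologicalSpace G] [ChartedSpace HG G]
    [BoundarylessManifold IG G] [T2Space G] [Group G] [LieGroup IG ∞ G]
    -- the smooth actions of `G` on `M` and `Q`, the action of `K` on `Q`
    [MulAction G M] [ContMDiffSMul IG IM ∞ G M]
    [MulAction G Q] [ContMDiffSMul IG IQ ∞ G Q]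
    [MulAction Kᵐᵒᵖ Q] [SMulCommClass G Kᵐᵒᵖ Q]
    -- the `G`-equivariant principal `K`-bundle `Q → M` and a connection on it
    (B : SmoothPrincipalBundle IM IQ IK M Q K)
    (hB : ∀ (g : G) (q : Q), B.proj (g • q) = g • B.proj q)
    (Θ : PrincipalConnection B) :
    (Θ.IsInvariant G ↔
      VectorOneForm.pullback ((IG.prod IM).prod IK) ((IG.prod IM).prod IK) (actionIso IG B hB)
          (bundlePullback (faceOne IG IM G M) B Θ.form) =
        bundlePullback (faceZero IG IM G M) B Θ.form -
          contractedPullback (faceZero IG IM G M) B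
            (VectorOneForm.pullback (IG.prod IM) IG Prod.fst (maurerCartan IG G)) Θ.form) ∧
    (Θ.IsBasic IG G ↔ Θ.IsInvariant G ∧
      VectorOneForm.pullback ((IG.prod IM).prod IK) ((IG.prod IM).prod IK) (actionIso IG B hB)
          (bundlePullback (faceOne IG IM G M) B Θ.form) =
        bundlePullback (faceZero IG IM G M) B Θ.form) := by
  have hpull := pullback_actionIso_apply (IG := IG) B hB Θ.form
  have hΘsub : ∀ (q : Q) (u v : EQ), (Θ.form q : EQ →L[ℝ] EK) (u - v) =
      (Θ.form q : EQ →L[ℝ] EK) u - (Θ.form q : EQ →L[ℝ] EK) v :=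
    fun q ↦ (Θ.form q : EQ →L[ℝ] EK).map_sub
  have hinv : Θ.IsInvariant G →
      VectorOneForm.pullback ((IG.prod IM).prod IK) ((IG.prod IM).prod IK) (actionIso IG B hB)
          (bundlePullback (faceOne IG IM G M) B Θ.form) =
        bundlePullback (faceZero IG IM G M) B Θ.form -
          contractedPullback (faceZero IG IM G M) B
            (VectorOneForm.pullback (IG.prod IM) IG Prod.fst (maurerCartan IG G)) Θ.form := by
    intro h
    funext p
    refine ContinuousLinearMap.ext fun w ↦ ?_
    rw [hpull, h p.base.1]
    exact hΘsub _ _ _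
  refine ⟨⟨hinv, fun h g ↦ ?_⟩, fun h ↦ ⟨h.1, ?_⟩, fun h ↦ ⟨h.1, fun A q ↦ ?_⟩⟩
  · funext q
    refine ContinuousLinearMap.ext fun u ↦ ?_
    obtain ⟨w, hw, hw0⟩ := exists_tangent_faceZeroLift (IG := IG) B g q u
    have h1 := DFunLike.congr_fun (congrFun h (faceZeroLift B g q)) w
    rw [hpull] at h1
    -- The correction term vanishes because ρ_q is linear and θ is zero on w.
    have h0 := (congrArg (leftVectorFieldL (IQ := IQ) IG q) hw0).trans
      (leftVectorFieldL (IQ := IQ) IG q).map_zero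
    have h2 : ∀ (η : EQ →L[ℝ] EK) (x r : EQ), x = u → r = 0 → η (x - r) = η u := by
      rintro η x _ hx rfl
      exact congrArg η ((sub_zero x).trans hx)
    -- Recombined by linearity, the right side of `h1` is Θ at the same difference at which the left
    -- side evaluates g^*Θ; that difference is u.
    exact (h2 _ _ _ hw h0).symm.trans
      (h1.trans ((hΘsub _ _ _).symm.trans (h2 (Θ.form q) _ _ hw h0)))
  · rw [hinv h.1, sub_eq_self]
    funext p
    exact ContinuousLinearMap.ext fun w ↦ h.2 _ _
  · obtain ⟨w, hw⟩ := exists_tangent_maurerCartan (IG := IG) B q A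
    -- The formula of part 1 and the hypothesis both compute Ψ^*d₁^*Θ, so the contracted term is
    -- zero; evaluating it on w gives Θ(ρ_q(A)) = 0.
    have h1 := sub_eq_self.1 ((hinv h.1).symm.trans h.2)
    have h2 := DFunLike.congr_fun (congrFun h1 (faceZeroLift B 1 q)) w
    exact (congrArg (fun v ↦ Θ.form q (leftVectorField IQ v q)) hw).symm.trans h2
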